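/- Let $d\ge 1$ and $0\le k<d$ be integers, and equip $\mathbb{R}^d$ with the Euclidean norm. Write $B(x,\rho)$ for the closed ball with center $x$ and radius $\rho$, $\mathcal{L}^{(\varepsilon)}=\{x:\operatorname{dist}(x,\mathcal{L})\le\varepsilon\}$ for the closed $\varepsilon$-neighborhood of an affine subspace $\mathcal{L}$, and $\dim$ for Hausdorff dimension. Let $\mu$ be a locally finite Borel measure on $\mathbb{R}^d$ such that: (1) $\mu$ is absolutely decaying: there are $C,\gamma,\rho_0>0$ such that $$\mu\big(B(x,\rho)\cap\mathcal{L}^{(\varepsilon)}\big)<C\left(\frac{\varepsilon}{\rho}\right)^{\gamma}\mu\big(B(x,\rho)\big)$$ for all $0<\rho<\rho_0$, all $x\in\operatorname{supp}\mu$, all affine hyperplanes $\mathcal{L}\subset\mathbb{R}^d$ and all $\varepsilon>0$; (2) $\mu$ is Ahlfors regular: there are $\delta,c_1,c_2,\rho_0>0$ such that $c_1\rho^\delta\le\mu(B(x,\rho))\le c_2\rho^\delta$ for all $x\in\operatorname{supp}\mu$ and all $0<\rho<\rho_0$. Let $S\subset\mathbb{R}^d$ be $k$-dimensionally absolute winning,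 that is, for every $0<\beta<1/3$ Alice has a strategy in the following game which guarantees, however Bob plays, that $\bigcap_i B_i\cap S\ne\varnothing$. Bob first chooses a ball $B_1=B(x_1,\rho_1)$ with $\rho_1>0$. At stage $i$, after Bob has chosen $B_i=B(x_i,\rho_i)$, Alice chooses a $k$-dimensional affine subspace $\mathcal{L}_i$ and $0<\varepsilon_i\le\beta$, and then Bob chooses a ball $B_{i+1}=B(x_{i+1},\rho_{i+1})\subset B_i\smallsetminus\mathcal{L}_i^{(\varepsilon_i\rho_i)}$ with $\rho_{i+1}\ge\beta\rho_i$. Then $S$ is strongly $C^1$ incompressible on $K=\operatorname{supp}\mu$: for every open $U\subset\mathbb{R}^d$ with $U\cap K\ne\varnothing$ and every sequence $(f_i)_{i\ge1}$ of $C^1$ diffeomorphisms of $U$ onto (possibly different) open subsets of $\mathbb{R}^d$, $$\dim\Big(\bigcap_{i=1}^\infty f_i^{-1}(S)\cap K\Big)=\dim(U\cap K).$$ -/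

import Mathlib

open MeasureTheory Metric

/-- `L` is an affine subspace of `ℝ^d` of dimension `k` (in particular it is nonempty). -/
def IsAffineOfDim {d : ℕ} (k : ℕ) (L : AffineSubspace ℝ (EuclideanSpace ℝ (Fin d))) : Prop :=
  (L : Set (EuclideanSpace ℝ (Fin d))).Nonempty ∧ Module.finrank ℝ L.direction = k

/-- A move of Alice in the `k`-dimensional `β`-absolute game on `ℝ^d`: a `k`-dimensional affine
subspace together with a relative width `0 < ε ≤ β`. -/
structure AliceMove (d k : ℕ) (β : ℝ) where
  /-- the subspace a neighborhood of which is removed -/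
  L : AffineSubspace ℝ (EuclideanSpace ℝ (Fin d))
  /-- the width of the neighborhood, relative to the radius of Bob's current ball -/
  ε : ℝ
  isAffineOfDim : IsAffineOfDim k L
  ε_pos : 0 < ε
  ε_le : ε ≤ β

/-- A strategy of Alice: her answer to every finite sequence of balls (center, radius) chosen by
Bob so far. -/
def AliceStrategy (d k : ℕ) (β : ℝ) : Type :=
  (n : ℕ) → (Fin (n + 1) → EuclideanSpace ℝ (Fin d) × ℝ) → AliceMove d k β

/-- Alice's answer, under the strategy `σ`, at stage `n` of the game in which Bob chooses the
balls `B(x i, ρ i)`. -/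
def AliceStrategy.answer {d k : ℕ} {β : ℝ} (σ : AliceStrategy d k β)
    (x : ℕ → EuclideanSpace ℝ (Fin d)) (ρ : ℕ → ℝ) (n : ℕ) : AliceMove d k β :=
  σ n (fun i => (x i, ρ i))

/-- The infinite sequence of balls `B(x n, ρ n)` is a legal play of Bob against Alice's
strategy `σ`. The removed set is the closed `ε ρ n`-neighborhood of Alice's subspace. -/
def IsLegalPlay {d k : ℕ} {β : ℝ} (σ : AliceStrategy d k β)
    (x : ℕ → EuclideanSpace ℝ (Fin d)) (ρ : ℕ → ℝ) : Prop :=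
  (∀ n, 0 < ρ n) ∧ (∀ n, β * ρ n ≤ ρ (n + 1)) ∧
    ∀ n, closedBall (x (n + 1)) (ρ (n + 1)) ⊆
      closedBall (x n) (ρ n) \
        cthickening ((σ.answer x ρ n).ε * ρ n)
          ((σ.answer x ρ n).L : Set (EuclideanSpace ℝ (Fin d)))

/-- `S` is `k`-dimensionally `β`-absolute winning: Alice has a strategy guaranteeing that the
intersection of Bob's balls meets `S`. (For `k < d` and `β < 1/3` Bob always has a legal move, so
that the game never stops after finitely many steps.) -/
def IsBetaAbsoluteWinning {d : ℕ} (k : ℕ) (β : ℝ) (S : Set (EuclideanSpace ℝ (Fin d))) : Prop :=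
  ∃ σ : AliceStrategy d k β, ∀ (x : ℕ → EuclideanSpace ℝ (Fin d)) (ρ : ℕ → ℝ),
    IsLegalPlay σ x ρ → ((⋂ n, closedBall (x n) (ρ n)) ∩ S).Nonempty

/-- `S` is `k`-dimensionally absolute winning. -/
def IsAbsoluteWinning {d : ℕ} (k : ℕ) (S : Set (EuclideanSpace ℝ (Fin d))) : Prop :=
  ∀ β : ℝ, 0 < β → β < 1 / 3 → IsBetaAbsoluteWinning k β S

/-- `μ` is absolutely decaying: it is `(C, γ)`-absolutely decaying for some `C, γ > 0`. An affine
hyperplane is an affine subspace of dimension `m` with `m + 1 = d`. -/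
def IsAbsolutelyDecaying {d : ℕ} (μ : Measure (EuclideanSpace ℝ (Fin d))) : Prop :=
  ∃ C γ ρ₀ : ℝ, 0 < C ∧ 0 < γ ∧ 0 < ρ₀ ∧
    ∀ ρ : ℝ, 0 < ρ → ρ < ρ₀ → ∀ x ∈ μ.support,
      ∀ (m : ℕ) (L : AffineSubspace ℝ (EuclideanSpace ℝ (Fin d))), m + 1 = d → IsAffineOfDim m L →
        ∀ ε : ℝ, 0 < ε →
          μ (closedBall x ρ ∩ cthickening ε (L : Set (EuclideanSpace ℝ (Fin d)))) <
            ENNReal.ofReal (C * (ε / ρ) ^ γ) * μ (closedBall x ρ)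

/-- `μ` is Ahlfors regular: it is `δ`-Ahlfors regular for some `δ > 0`. -/
def IsAhlforsRegular {d : ℕ} (μ : Measure (EuclideanSpace ℝ (Fin d))) : Prop :=
  ∃ δ c₁ c₂ ρ₀ : ℝ, 0 < δ ∧ 0 < c₁ ∧ 0 < c₂ ∧ 0 < ρ₀ ∧
    ∀ x ∈ μ.support, ∀ ρ : ℝ, 0 < ρ → ρ < ρ₀ →
      ENNReal.ofReal (c₁ * ρ ^ δ) ≤ μ (closedBall x ρ) ∧
        μ (closedBall x ρ) ≤ ENNReal.ofReal (c₂ * ρ ^ δ)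

/-- `f` restricts to a `C¹` diffeomorphism of the open set `U` onto an open subset of `ℝ^d`;
`g` is the inverse. The values of `f` outside `U` are irrelevant. -/
def IsC1DiffeoOn {d : ℕ} (f : EuclideanSpace ℝ (Fin d) → EuclideanSpace ℝ (Fin d))
    (U : Set (EuclideanSpace ℝ (Fin d))) : Prop :=
  IsOpen (f '' U) ∧ ContDiffOn ℝ 1 f U ∧
    ∃ g : EuclideanSpace ℝ (Fin d) → EuclideanSpace ℝ (Fin d),
      ContDiffOn ℝ 1 g (f '' U) ∧ ∀ x ∈ U, g (f x) = x

/-- `S` is strongly `C¹` incompressible on `K`. As `f i` is a map on `U`, its preimage of `S` is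
`U ∩ f i ⁻¹' S`. -/
def IsStronglyC1Incompressible {d : ℕ} (S K : Set (EuclideanSpace ℝ (Fin d))) : Prop :=
  ∀ U : Set (EuclideanSpace ℝ (Fin d)), IsOpen U → (U ∩ K).Nonempty →
    ∀ f : ℕ → EuclideanSpace ℝ (Fin d) → EuclideanSpace ℝ (Fin d),
      (∀ i, IsC1DiffeoOn (f i) U) →
        dimH ((⋂ i, U ∩ f i ⁻¹' S) ∩ K) = dimH (U ∩ K)

/-! Regularity gives `dimH` of the support at most `δ`, so it suffices to find dimension at least
`s` in the intersection for each `0 < s < δ`. All the games, one for each `f i`, are played at once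
along the branches of a tree of points of the support, whose level `n` has scale `r₀ * β ^ n`. Decay
lets a ball discard a neighborhood of any one hyperplane and still keep half the mass of a
concentric ball. Regularity then provides `N` separated children outside it, with `N * β ^ s ≥ 1`
when `β` is small (`exists_separated_children`); such a tree has limit set of dimension at least `s`
(`le_dimH_of_tree`). At small scales the `f i`-preimage of what Alice removes lies near a hyperplane
(`IsC1DiffeoOn.exists_hyperplane`). The games have pairwise disjoint arithmetic progressions of
levels as turns, so each level has at most one hyperplane to avoid. Game `i` starts late enough for
its linearization to be valid, and its turns are spaced so widely that its parameter `b i` absorbs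
the distortion of `f i`. This is possible because `S` wins for every small parameter. Every limit is
then sent into `S` by every `f i` (`mem_of_avoids_answers`). -/

open Filter Topology Set

/-! ### Lower bounds for Hausdorff dimension from trees -/

/-- The history of a branch of a tree of points: the first `n + 1` entries of `branchHistory y x₀ a n`
are the vertices chosen up to level `n` along the digit sequence `a`. -/
noncomputable def branchHistory {E : Type*} {N : ℕ} (y : ℕ → (ℕ → E) → Fin N → E) (x₀ : E)
    (a : ℕ → Fin N) : ℕ → ℕ → E
  | 0 => fun _ => x₀
  | n + 1 => Function.update (branchHistory y x₀ a n) (n + 1) (y n (branchHistory y x₀ a n) (a n))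

theorem branchHistory_eq {E : Type*} {N : ℕ} (y : ℕ → (ℕ → E) → Fin N → E) (x₀ : E)
    (a : ℕ → Fin N) {n j : ℕ} (hj : j ≤ n) :
    branchHistory y x₀ a n j = branchHistory y x₀ a j j := by
  induction n, hj using Nat.le_induction with
  | base => rfl
  | succ n hn ih =>
    rw [branchHistory, Function.update_of_ne (by omega), ih]

theorem branchHistory_succ {E : Type*} {N : ℕ} (y : ℕ → (ℕ → E) → Fin N → E) (x₀ : E)
    (a : ℕ → Fin N) (n : ℕ) :
    branchHistory y x₀ a (n + 1) (n + 1) = y n (branchHistory y x₀ a n) (a n) := by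
  rw [branchHistory, Function.update_self]

theorem branchHistory_congr {E : Type*} {N : ℕ} (y : ℕ → (ℕ → E) → Fin N → E) (x₀ : E)
    {a b : ℕ → Fin N} {n : ℕ} (h : ∀ i < n, a i = b i) :
    branchHistory y x₀ a n = branchHistory y x₀ b n := by
  induction n with
  | zero => rfl
  | succ n ih =>
    rw [branchHistory, branchHistory, ih fun i hi => h i (by omega), h n (by omega)]

/-- A set which contains an injective image of the space of digit sequences in base `N`, with
sequences that first differ at `m` mapped to points at distance at least `c * β ^ m`, has Hausdorff
dimension at least `s` if `1 ≤ N * β ^ s`. -/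
theorem le_dimH_of_digit_separated {E : Type*} [MetricSpace E] {N : ℕ} (hN : 1 < N)
    {β c s : ℝ} (hβ : 0 < β) (hc : 0 < c) (hs : 0 < s) (hNs : 1 ≤ N * β ^ s)
    (Φ : (ℕ → Fin N) → E)
    (hΦ : ∀ a b m, (∀ i < m, a i = b i) → a m ≠ b m → c * β ^ m ≤ dist (Φ a) (Φ b))
    {T : Set E} (hT : ∀ a, Φ a ∈ T) : ENNReal.ofReal s ≤ dimH T := by
  have hne : ∀ a b : ℕ → Fin N, a ≠ b → ∃ m, (∀ i < m, a i = b i) ∧ a m ≠ b m := by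
    intro a b hab
    have h : ∃ m, a m ≠ b m := Function.ne_iff.1 hab
    classical
    exact ⟨Nat.find h, fun i hi => not_not.1 (Nat.find_min h hi), Nat.find_spec h⟩
  have hinj : Function.Injective Φ := by
    intro a b hab
    by_contra h
    obtain ⟨m, h1, h2⟩ := hne a b h
    have := hΦ a b m h1 h2
    rw [hab, dist_self] at this
    have : 0 < c * β ^ m := by positivity
    linarith
  have : Nonempty (Fin N) := ⟨⟨0, by omega⟩⟩
  -- Reading the digits of a point as a base-`N` expansion is `s`-Hölder on the range of `Φ`,
  -- because `N⁻¹ ≤ β ^ s`, and it maps onto `[0, 1]`. Values of `ψ` off the range play no role.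
  set ψ : E → ℝ := fun p => Real.ofDigits (Function.invFun Φ p) with hψ
  have hψΦ : ∀ a, ψ (Φ a) = Real.ofDigits a := fun a => by
    simp only [hψ, Function.leftInverse_invFun hinj a]
  have hN0 : (0 : ℝ) < N := by exact_mod_cast (by omega : 0 < N)
  have hhol : HolderOnWith (Real.toNNReal (c⁻¹ ^ s)) (Real.toNNReal s) ψ (range Φ) := by
    rintro _ ⟨a, rfl⟩ _ ⟨b, rfl⟩
    rw [hψΦ, hψΦ]
    by_cases hab : a = b
    · subst hab; simp
    obtain ⟨m, h1, h2⟩ := hne a b hab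
    have hd := hΦ a b m h1 h2
    have hle := Real.abs_ofDigits_sub_ofDigits_le h1
    rw [edist_dist, edist_dist, Real.coe_toNNReal _ hs.le,
      ENNReal.ofReal_rpow_of_nonneg dist_nonneg hs.le, ← ENNReal.ofReal,
      ← ENNReal.ofReal_mul (by positivity)]
    apply ENNReal.ofReal_le_ofReal
    rw [Real.dist_eq]
    refine hle.trans ?_
    have e1 : ((N : ℝ) ^ m)⁻¹ ≤ (β ^ s) ^ m := by
      rw [inv_le_iff_one_le_mul₀ (by positivity), ← mul_pow]
      exact one_le_pow₀ (by linarith)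
    refine e1.trans ?_
    rw [← Real.mul_rpow (by positivity) dist_nonneg, ← Real.rpow_natCast, ← Real.rpow_mul hβ.le,
      mul_comm s, Real.rpow_mul hβ.le, Real.rpow_natCast]
    apply Real.rpow_le_rpow (by positivity) _ hs.le
    rw [inv_mul_eq_div, le_div_iff₀ hc]
    linarith
  have h1 := hhol.dimH_image_le (Real.toNNReal_pos.2 hs)
  have h2 : Icc (0 : ℝ) 1 ⊆ ψ '' range Φ := by
    intro t ht
    obtain ⟨a, -, ha⟩ := Real.ofDigits_SurjOn hN ht
    exact ⟨Φ a, mem_range_self a, by rw [hψΦ, ha]⟩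
  have h3 : dimH (Icc (0 : ℝ) 1) = 1 := by
    rw [Real.dimH_of_nonempty_interior (by simp)]; simp
  have h4 : (1 : ENNReal) ≤ dimH (range Φ) / (Real.toNNReal s : ENNReal) := by
    rw [← h3]; exact (dimH_mono h2).trans h1
  have h5 : dimH (range Φ) ≤ dimH T := dimH_mono (range_subset_iff.2 hT)
  refine le_trans ?_ h5
  rw [ENNReal.le_div_iff_mul_le (Or.inl (by simpa using hs)) (Or.inl (by simp)), one_mul] at h4
  exact h4

/-- A set which contains all limits of the branches of a tree of points, where each vertex of level
`n` has `N` children at mutual distances at least `3 * β * (r₀ * β ^ n)`, has Hausdorff dimension at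
least `s` if `1 ≤ N * β ^ s`. The choice of the children may depend on the whole history. -/
theorem le_dimH_of_tree {E : Type*} [MetricSpace E] [CompleteSpace E] {N : ℕ} (hN : 1 < N)
    {β r₀ s : ℝ} (hβ : 0 < β) (hβ1 : β < 1) (hr : 0 < r₀) (hs : 0 < s) (hNs : 1 ≤ N * β ^ s)
    (V : ℕ → Set E) (Q : ℕ → (ℕ → E) → E → Prop)
    (hQ : ∀ n x x' y, (∀ j ≤ n, x j = x' j) → Q n x y → Q n x' y) {x₀ : E} (hx₀ : x₀ ∈ V 0)
    (hchild : ∀ n (x : ℕ → E), x n ∈ V n → ∃ y : Fin N → E,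
      (∀ j, y j ∈ V (n + 1) ∧ dist (x n) (y j) ≤ (1 - β) * (r₀ * β ^ n) ∧ Q n x (y j)) ∧
        Pairwise fun i j => 3 * β * (r₀ * β ^ n) ≤ dist (y i) (y j))
    {T : Set E} (hT : ∀ x : ℕ → E, (∀ n, x n ∈ V n) →
      (∀ n, dist (x n) (x (n + 1)) ≤ (1 - β) * (r₀ * β ^ n)) → (∀ n, Q n x (x (n + 1))) →
        ∀ z, Tendsto x atTop (𝓝 z) → z ∈ T) : ENNReal.ofReal s ≤ dimH T := by
  have : Nonempty E := ⟨x₀⟩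
  choose! y hy hsep using hchild
  set X : (ℕ → Fin N) → ℕ → E := fun a n => branchHistory y x₀ a n n with hX
  have hXV : ∀ a n, X a n ∈ V n := by
    intro a n
    induction n with
    | zero => exact hx₀
    | succ n ih =>
      simp only [hX, branchHistory_succ]
      exact (hy n (branchHistory y x₀ a n) ih (a n)).1
  have hXd : ∀ a n, dist (X a n) (X a (n + 1)) ≤ (1 - β) * (r₀ * β ^ n) := by
    intro a n
    simp only [hX, branchHistory_succ]
    exact (hy n (branchHistory y x₀ a n) (hXV a n) (a n)).2.1
  have hXQ : ∀ a n, Q n (X a) (X a (n + 1)) := by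
    intro a n
    refine hQ n (branchHistory y x₀ a n) _ _ (fun j hj => branchHistory_eq y x₀ a hj) ?_
    simp only [hX, branchHistory_succ]
    exact (hy n (branchHistory y x₀ a n) (hXV a n) (a n)).2.2
  have hXd' : ∀ a n, dist (X a n) (X a (n + 1)) ≤ ((1 - β) * r₀) * β ^ n := by
    intro a n; rw [mul_assoc]; exact hXd a n
  have hlim : ∀ a, ∃ z, Tendsto (X a) atTop (𝓝 z) := fun a =>
    cauchySeq_tendsto_of_complete (cauchySeq_of_le_geometric β _ hβ1 (hXd' a))
  choose Φ hΦ using hlim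
  have hdist : ∀ a n, dist (X a n) (Φ a) ≤ r₀ * β ^ n := by
    intro a n
    refine (dist_le_of_le_geometric_of_tendsto β _ hβ1 (hXd' a) (hΦ a) n).trans_eq ?_
    have : 1 - β ≠ 0 := by linarith
    field_simp
  -- Siblings are `3 * β * r₀ * β ^ m` apart and each limit is within `β * r₀ * β ^ m` of its
  -- vertex, which leaves `β * r₀ * β ^ m`.
  refine le_dimH_of_digit_separated hN (c := β * r₀) hβ (by positivity) hs hNs Φ ?_
    fun a => hT (X a) (hXV a) (hXd a) (hXQ a) _ (hΦ a)
  intro a b m hab hm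
  have h1 : 3 * β * (r₀ * β ^ m) ≤ dist (X a (m + 1)) (X b (m + 1)) := by
    simp only [hX, branchHistory_succ, branchHistory_congr y x₀ hab]
    exact hsep m (branchHistory y x₀ b m) (hXV b m) hm
  have h2 := hdist a (m + 1)
  have h3 := hdist b (m + 1)
  have h4 := dist_triangle4 (X a (m + 1)) (Φ a) (Φ b) (X b (m + 1))
  rw [dist_comm (Φ b)] at h4
  rw [pow_succ] at h2 h3
  nlinarith

/-! ### Separated nets and the upper bound for the dimension -/

theorem exists_finset_separated_cover {E : Type*} [MetricSpace E] [ProperSpace E] {A : Set E}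
    (hA : Bornology.IsBounded A) {r : ℝ} (hr : 0 < r) :
    ∃ t : Finset E, ↑t ⊆ A ∧ (t : Set E).Pairwise (fun x y => r < dist x y) ∧
      A ⊆ ⋃ y ∈ t, closedBall y r := by
  have htb : TotallyBounded A := hA.isCompact_closure.totallyBounded.subset subset_closure
  lift r to NNReal using hr.le
  have hfin : packingNumber r A ≠ ⊤ := by
    have h := packingNumber_two_mul_le_externalCoveringNumber (r / 2) A
    rw [mul_div_cancel₀ _ two_ne_zero] at h
    obtain ⟨C, hCA, hCfin, hC⟩ := exists_finite_isCover_of_totallyBounded (ε := r / 2)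
      (by have : 0 < r := by exact_mod_cast hr
          positivity) htb
    exact ne_top_of_le_ne_top (by simpa using hCfin) (h.trans hC.externalCoveringNumber_le_encard)
  have hf : (maximalSeparatedSet r A).Finite := by
    rw [← Set.encard_ne_top_iff, encard_maximalSeparatedSet hfin]; exact hfin
  refine ⟨hf.toFinset, ?_, ?_, ?_⟩
  · simpa using maximalSeparatedSet_subset
  · intro x hx y hy hxy
    have : (r : ENNReal) < edist x y :=
      isSeparated_maximalSeparatedSet (by simpa using hx) (by simpa using hy) hxy
    rw [edist_dist, ← ENNReal.ofReal_coe_nnreal] at this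
    exact (ENNReal.ofReal_lt_ofReal_iff_of_nonneg hr.le).1 this
  · simpa using isCover_iff_subset_iUnion_closedBall.1 (isCover_maximalSeparatedSet hfin)

/-- Balls of radius `ρ / 2` around a `ρ`-separated net are disjoint and each has mass at least `c *
(ρ / 2) ^ δ`, so a bounded piece is covered by `O(ρ ^ (-δ))` balls of radius `ρ`. Hence its
`δ`-dimensional Hausdorff measure is finite. -/
theorem dimH_support_le_of_le_measure_closedBall {E : Type*} [MetricSpace E] [ProperSpace E]
    [MeasurableSpace E] [BorelSpace E] (μ : Measure E) [IsLocallyFiniteMeasure μ]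
    {δ c ρ₀ : ℝ} (hδ : 0 < δ) (hc : 0 < c) (hρ₀ : 0 < ρ₀) {K : Set E}
    (h : ∀ x ∈ K, ∀ ρ : ℝ, 0 < ρ → ρ < ρ₀ → ENNReal.ofReal (c * ρ ^ δ) ≤ μ (closedBall x ρ)) :
    dimH K ≤ ENNReal.ofReal δ := by
  rcases K.eq_empty_or_nonempty with rfl | ⟨o, -⟩
  · simp
  have hK : K = ⋃ n : ℕ, K ∩ closedBall o n := by
    rw [← inter_iUnion, iUnion_closedBall_nat, inter_univ]
  rw [hK, dimH_iUnion]
  refine iSup_le fun n => ?_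
  set F := K ∩ closedBall o n with hF
  have hFb : Bornology.IsBounded F := isBounded_closedBall.subset inter_subset_right
  set ρ : ℕ → ℝ := fun j => ρ₀ / (j + 1) with hρ
  have hρpos : ∀ j, 0 < ρ j := fun j => by positivity
  have hρle : ∀ j, ρ j ≤ ρ₀ := fun j => div_le_self hρ₀.le (by linarith [j.cast_nonneg (α := ℝ)])
  have hρlim : Tendsto ρ atTop (𝓝 0) := by
    simpa [hρ, Function.comp_def] using
      (tendsto_const_div_atTop_nhds_zero_nat ρ₀).comp (tendsto_add_atTop_nat 1)
  choose t htF htsep htcov using fun j => exists_finset_separated_cover hFb (hρpos j)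
  have hMfin : μ (closedBall o (n + ρ₀)) ≠ ⊤ := (isCompact_closedBall _ _).measure_lt_top.ne
  set M := (μ (closedBall o (n + ρ₀))).toReal with hM
  have hcard : ∀ j, ((t j).card : ℝ) * (c * (ρ j / 2) ^ δ) ≤ M := by
    intro j
    have h1 : ∑ y ∈ t j, μ (closedBall y (ρ j / 2)) ≤ μ (closedBall o (n + ρ₀)) := by
      rw [← measure_biUnion_finset _ fun _ _ => isClosed_closedBall.measurableSet]
      · refine measure_mono (iUnion₂_subset fun y hy => closedBall_subset_closedBall' ?_)
        have := mem_closedBall.1 (htF j hy).2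
        linarith [hρle j, hρpos j]
      · intro x hx y hy hxy
        exact closedBall_disjoint_closedBall (by linarith [htsep j hx hy hxy])
    have h2 : ∑ y ∈ t j, ENNReal.ofReal (c * (ρ j / 2) ^ δ) ≤ μ (closedBall o (n + ρ₀)) :=
      (Finset.sum_le_sum fun y hy => h y (htF j hy).1 _ (by linarith [hρpos j])
        (by linarith [hρpos j, hρle j])).trans h1
    have h3 := hρpos j
    rw [Finset.sum_const, nsmul_eq_mul, ← ENNReal.ofReal_natCast,
      ← ENNReal.ofReal_mul (Nat.cast_nonneg _)] at h2
    exact (ENNReal.ofReal_le_iff_le_toReal hMfin).1 h2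
  have key : Measure.hausdorffMeasure δ F ≤ ENNReal.ofReal (M * 4 ^ δ / c) := by
    refine (Measure.hausdorffMeasure_le_liminf_sum δ F (l := atTop)
      (fun j => ENNReal.ofReal (2 * ρ j)) ?_ (fun j (y : t j) => closedBall (y : E) (ρ j)) ?_ ?_).trans ?_
    · have := ENNReal.tendsto_ofReal (hρlim.const_mul 2)
      simpa using this
    · refine Eventually.of_forall fun j y => ?_
      refine ediam_le fun p hp q hq => ?_
      rw [edist_dist]
      apply ENNReal.ofReal_le_ofReal
      linarith [dist_triangle_right p q y, mem_closedBall.1 hp, mem_closedBall.1 hq]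
    · refine Eventually.of_forall fun j p hp => ?_
      obtain ⟨y, hy, hpy⟩ := mem_iUnion₂.1 (htcov j hp)
      exact mem_iUnion.2 ⟨⟨y, hy⟩, hpy⟩
    · have hb : ∀ j, ∑ y : t j, ediam (closedBall (y : E) (ρ j)) ^ δ ≤
          ENNReal.ofReal (M * 4 ^ δ / c) := by
        intro j
        have h3 := hρpos j
        have h1 : ∀ y : t j, ediam (closedBall (y : E) (ρ j)) ^ δ ≤
            ENNReal.ofReal ((2 * ρ j) ^ δ) := by
          intro y
          rw [← ENNReal.ofReal_rpow_of_nonneg (by positivity) hδ.le]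
          refine ENNReal.rpow_le_rpow (ediam_le fun p hp q hq => ?_) hδ.le
          rw [edist_dist]
          apply ENNReal.ofReal_le_ofReal
          linarith [dist_triangle_right p q y, mem_closedBall.1 hp, mem_closedBall.1 hq]
        refine (Finset.sum_le_sum fun y _ => h1 y).trans ?_
        rw [Finset.sum_const, nsmul_eq_mul, ← ENNReal.ofReal_natCast,
          ← ENNReal.ofReal_mul (Nat.cast_nonneg _)]
        apply ENNReal.ofReal_le_ofReal
        simp only [Finset.card_univ, Fintype.card_coe]
        rw [le_div_iff₀ hc]
        have e : (2 * ρ j) ^ δ = (ρ j / 2) ^ δ * 4 ^ δ := by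
          rw [← Real.mul_rpow (by positivity) (by positivity)]; congr 1; ring
        rw [e]
        have := hcard j
        have h4 : (0 : ℝ) < 4 ^ δ := by positivity
        nlinarith
      refine (liminf_le_liminf (Eventually.of_forall hb)).trans ?_
      simp
  have := dimH_le_of_hausdorffMeasure_ne_top (s := F) (d := Real.toNNReal δ)
    (by rw [Real.coe_toNNReal _ hδ.le]; exact ne_top_of_le_ne_top ENNReal.ofReal_ne_top key)
  exact this

/-! ### Many separated children away from a hyperplane -/

/-- The part of the support in the half-size ball and outside the neighborhood of `L` carries at
least half the mass of that ball. Covering it by balls of radius `3 * β * r` takes at least a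
constant times `β ^ (-δ)` of them, which exceeds `β ^ (-s)` for small `β`. -/
theorem exists_separated_children {d : ℕ} {μ : Measure (EuclideanSpace ℝ (Fin d))}
    {C γ ρ₀ δ c₁ c₂ ρ₁ : ℝ} (hγ : 0 < γ)
    (hdec : ∀ ρ : ℝ, 0 < ρ → ρ < ρ₀ → ∀ x ∈ μ.support,
      ∀ (m : ℕ) (L : AffineSubspace ℝ (EuclideanSpace ℝ (Fin d))), m + 1 = d → IsAffineOfDim m L →
        ∀ ε : ℝ, 0 < ε →
          μ (closedBall x ρ ∩ cthickening ε (L : Set (EuclideanSpace ℝ (Fin d)))) <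
            ENNReal.ofReal (C * (ε / ρ) ^ γ) * μ (closedBall x ρ))
    (hc₁ : 0 < c₁) (hc₂ : 0 < c₂)
    (hreg : ∀ x ∈ μ.support, ∀ ρ : ℝ, 0 < ρ → ρ < ρ₁ →
      ENNReal.ofReal (c₁ * ρ ^ δ) ≤ μ (closedBall x ρ) ∧
        μ (closedBall x ρ) ≤ ENNReal.ofReal (c₂ * ρ ^ δ))
    {s : ℝ} (hs : 0 < s) (hsδ : s < δ) :
    ∃ (N : ℕ) (β : ℝ), 1 < N ∧ 0 < β ∧ β < 1 / 3 ∧ 1 ≤ N * β ^ s ∧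
      ∀ x ∈ μ.support, ∀ r : ℝ, 0 < r → r < min ρ₀ ρ₁ →
        ∀ (m : ℕ) (L : AffineSubspace ℝ (EuclideanSpace ℝ (Fin d))), m + 1 = d →
          IsAffineOfDim m L → ∃ y : Fin N → EuclideanSpace ℝ (Fin d),
            (∀ j, y j ∈ μ.support ∧ dist x (y j) ≤ (1 - β) * r ∧
              2 * β * r < infDist (y j) (L : Set (EuclideanSpace ℝ (Fin d)))) ∧
            Pairwise fun i j => 3 * β * r ≤ dist (y i) (y j) := by
  -- The `2` is the half of the mass lost to the neighborhood of `L`; the `6 ^ δ` comes from `3 * β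
  -- * r = 6 * β * (r / 2)`.
  set c : ℝ := c₁ / (2 * c₂ * 6 ^ δ) with hcdef
  have hc : 0 < c := by positivity
  -- `4 * β` is the relative width of the `2 * β * r`-neighborhood in the ball of radius `r / 2`.
  -- The bound `2` in the last condition gives `N ≥ 2` and pays for rounding down: `N * β ^ s ≥ 2 -
  -- β ^ s ≥ 1`.
  obtain ⟨β, hβ0, hβ4, hβγ, hβs⟩ : ∃ β : ℝ, 0 < β ∧ β < 1 / 4 ∧ C * (4 * β) ^ γ ≤ 1 / 2 ∧
      2 ≤ c * β ^ (-(δ - s)) := by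
    have h1 : ∀ᶠ β : ℝ in 𝓝[>] 0, 0 < β := self_mem_nhdsWithin
    have h2 : ∀ᶠ β : ℝ in 𝓝[>] 0, β < 1 / 4 :=
      mem_nhdsWithin_of_mem_nhds (Iio_mem_nhds (by norm_num))
    have h3 : ∀ᶠ β : ℝ in 𝓝[>] 0, C * (4 * β) ^ γ ≤ 1 / 2 := by
      have hcont : Continuous fun β : ℝ => C * (4 * β) ^ γ :=
        continuous_const.mul ((continuous_const.mul continuous_id).rpow_const fun _ => Or.inr hγ.le)
      have h := hcont.tendsto 0
      simp only [mul_zero, Real.zero_rpow hγ.ne'] at h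
      exact mem_nhdsWithin_of_mem_nhds (h (Iic_mem_nhds (by norm_num)))
    have h4 : ∀ᶠ β : ℝ in 𝓝[>] 0, 2 ≤ c * β ^ (-(δ - s)) :=
      ((tendsto_rpow_neg_nhdsGT_zero (by linarith)).const_mul_atTop hc).eventually_ge_atTop 2
    obtain ⟨β, h⟩ := (h1.and (h2.and (h3.and h4))).exists
    exact ⟨β, h⟩
  have hβmono : β ^ (-(δ - s)) ≤ β ^ (-δ) :=
    Real.rpow_le_rpow_of_exponent_ge hβ0 (by linarith) (by linarith)
  have hfl := Nat.sub_one_lt_floor (c * β ^ (-δ))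
  have hfle := Nat.floor_le (a := c * β ^ (-δ)) (by positivity)
  have hcβ : c * β ^ (-(δ - s)) ≤ c * β ^ (-δ) := by gcongr
  refine ⟨⌊c * β ^ (-δ)⌋₊, β, Nat.le_floor (by push_cast; linarith), hβ0, by linarith, ?_, ?_⟩
  · have e : β ^ (-(δ - s)) = β ^ (-δ) * β ^ s := by
      rw [← Real.rpow_add hβ0]; congr 1; ring
    have hs1 : β ^ s ≤ 1 := Real.rpow_le_one hβ0.le (by linarith) hs.le
    have hs0 : 0 < β ^ s := by positivity
    rw [e] at hβs
    nlinarith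
  intro x hx r hr hrρ m L hm hL
  have hr₀ := hrρ.trans_le (min_le_left _ _)
  have hr₁ := hrρ.trans_le (min_le_right _ _)
  set Th := cthickening (2 * β * r) (L : Set (EuclideanSpace ℝ (Fin d))) with hTh
  set A := (μ.support ∩ closedBall x (r / 2)) \ Th with hA
  have hAb : Bornology.IsBounded A :=
    isBounded_closedBall.subset (sdiff_subset.trans inter_subset_right)
  obtain ⟨t, htA, htsep, htcov⟩ := exists_finset_separated_cover hAb (r := 3 * β * r) (by positivity)
  have hball := hreg x hx (r / 2) (by linarith) (by linarith)
  have hfin : μ (closedBall x (r / 2)) ≠ ⊤ := ne_top_of_le_ne_top ENNReal.ofReal_ne_top hball.2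
  have hdecay : μ (closedBall x (r / 2) ∩ Th) ≤ ENNReal.ofReal (1 / 2) * μ (closedBall x (r / 2)) := by
    refine (hdec (r / 2) (by linarith) (by linarith) x hx m L hm hL (2 * β * r)
      (by positivity)).le.trans ?_
    gcongr
    have : 2 * β * r / (r / 2) = 4 * β := by field_simp; norm_num
    rwa [this]
  have hμA : μ A ≤ ENNReal.ofReal (t.card * (c₂ * (3 * β * r) ^ δ)) := by
    refine (measure_mono htcov).trans ((measure_biUnion_finset_le _ _).trans ?_)
    refine (Finset.sum_le_sum fun y hy => (hreg y (htA hy).1.1 (3 * β * r) (by positivity)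
      (by nlinarith)).2).trans_eq ?_
    rw [Finset.sum_const, nsmul_eq_mul, ← ENNReal.ofReal_natCast,
      ← ENNReal.ofReal_mul (Nat.cast_nonneg _)]
  have hsplit : μ (closedBall x (r / 2)) ≤
      ENNReal.ofReal (1 / 2) * μ (closedBall x (r / 2)) + μ A := by
    have hsub : closedBall x (r / 2) ⊆ ((closedBall x (r / 2) ∩ Th) ∪ A) ∪ μ.supportᶜ := by
      intro p hp
      by_cases h1 : p ∈ μ.support
      · by_cases h2 : p ∈ Th
        · exact Or.inl (Or.inl ⟨hp, h2⟩)
        · exact Or.inl (Or.inr ⟨⟨h1, hp⟩, h2⟩)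
      · exact Or.inr h1
    calc μ (closedBall x (r / 2)) ≤ μ (closedBall x (r / 2) ∩ Th) + μ A + μ μ.supportᶜ :=
          (measure_mono hsub).trans ((measure_union_le _ _).trans (by gcongr; exact measure_union_le _ _))
      _ ≤ _ := by rw [Measure.measure_compl_support, add_zero]; gcongr
  have hreal : c₁ * (r / 2) ^ δ ≤ 2 * (t.card * (c₂ * (3 * β * r) ^ δ)) := by
    set b := (μ (closedBall x (r / 2))).toReal with hb
    have hbe : μ (closedBall x (r / 2)) = ENNReal.ofReal b := (ENNReal.ofReal_toReal hfin).symm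
    have h1 := hsplit.trans (add_le_add_right hμA _)
    have hb0 : 0 ≤ b := ENNReal.toReal_nonneg
    have ht0 : 0 ≤ t.card * (c₂ * (3 * β * r) ^ δ) :=
      mul_nonneg (Nat.cast_nonneg _) (by positivity)
    rw [hbe, ← ENNReal.ofReal_mul (by norm_num), ← ENNReal.ofReal_add (by positivity) ht0,
      ENNReal.ofReal_le_ofReal_iff (add_nonneg (by positivity) ht0)] at h1
    have h2 := hball.1
    rw [hbe, ENNReal.ofReal_le_ofReal_iff hb0] at h2
    linarith
  have hcard : ⌊c * β ^ (-δ)⌋₊ ≤ t.card := by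
    have : c * β ^ (-δ) ≤ t.card := by
      have e : (r / 2) ^ δ * (6 ^ δ * β ^ δ) = (3 * β * r) ^ δ := by
        rw [← Real.mul_rpow (by norm_num) hβ0.le, ← Real.mul_rpow (by positivity) (by positivity)]
        congr 1; ring
      rw [← e] at hreal
      have h0 : 0 < (r / 2) ^ δ := by positivity
      have h1 : c₁ ≤ 2 * (t.card * (c₂ * (6 ^ δ * β ^ δ))) := by
        by_contra! hcon
        nlinarith
      rw [hcdef, Real.rpow_neg hβ0.le, ← div_eq_mul_inv, div_div, div_le_iff₀ (by positivity)]
      linarith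
    exact_mod_cast hfle.trans this
  obtain ⟨t', ht', hcard'⟩ := Finset.exists_subset_card_eq hcard
  set e := t'.equivFinOfCardEq hcard' with he
  refine ⟨fun j => (e.symm j : EuclideanSpace ℝ (Fin d)), fun j => ?_, fun i j hij => ?_⟩
  · obtain ⟨⟨h1, h2⟩, h3⟩ := htA (ht' (e.symm j).2)
    refine ⟨h1, ?_, ?_⟩
    · rw [dist_comm]
      have := mem_closedBall.1 h2
      nlinarith
    · rw [hTh, mem_cthickening_iff, not_le] at h3
      rwa [infDist, ← ENNReal.ofReal_lt_iff_lt_toReal (by positivity)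
        (infEDist_ne_top hL.1)]
  · refine (htsep (ht' (e.symm i).2) (ht' (e.symm j).2) ?_).le
    intro h
    exact hij (e.symm.injective (Subtype.ext h))

/-! ### Preimages of affine subspaces under diffeomorphisms -/

/-- The preimage of a neighborhood of a proper affine subspace under a map which is close to an
invertible affine map is contained in a neighborhood of a hyperplane. -/
theorem exists_hyperplane_of_approx {d k : ℕ} (hk : k < d)
    {L : AffineSubspace ℝ (EuclideanSpace ℝ (Fin d))} (hL : IsAffineOfDim k L)
    (A B : EuclideanSpace ℝ (Fin d) →L[ℝ] EuclideanSpace ℝ (Fin d))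
    (hBA : ∀ v, B (A v) = v) (hAB : ∀ v, A (B v) = v) {b : ℝ} (hb : 0 < b) (hB : ‖B‖ ≤ b)
    (x q : EuclideanSpace ℝ (Fin d)) :
    ∃ (m : ℕ) (H : AffineSubspace ℝ (EuclideanSpace ℝ (Fin d))), m + 1 = d ∧ IsAffineOfDim m H ∧
      ∀ (y z : EuclideanSpace ℝ (Fin d)) (η θ : ℝ), ‖z - q - A (y - x)‖ ≤ η →
        infDist z (L : Set (EuclideanSpace ℝ (Fin d))) < θ →
          infDist y (H : Set (EuclideanSpace ℝ (Fin d))) ≤ b * (η + θ) := by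
  obtain ⟨⟨p₁, hp₁⟩, hdim⟩ := hL
  have hlt : L.direction < ⊤ := by
    rw [lt_top_iff_ne_top]
    rintro h
    rw [h, finrank_top, finrank_euclideanSpace_fin] at hdim
    omega
  -- A nonzero functional killing the direction of `L` enlarges `L` to a hyperplane; composing with
  -- `A` pulls that hyperplane back.
  obtain ⟨φ, hφ0, hφ⟩ := Submodule.exists_le_ker_of_lt_top _ hlt
  set ψ : Module.Dual ℝ (EuclideanSpace ℝ (Fin d)) := φ ∘ₗ (A : _ →ₗ[ℝ] _) with hψ
  have hψ0 : ψ ≠ 0 := by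
    intro h
    apply hφ0
    ext v
    have := LinearMap.congr_fun h (B v)
    simpa [hψ, hAB] using this
  set p₀ := x + B (p₁ - q) with hp₀
  have hker : Module.finrank ℝ (LinearMap.ker ψ) + 1 = d := by
    rw [Module.Dual.finrank_ker_add_one_of_ne_zero hψ0, finrank_euclideanSpace_fin]
  refine ⟨_, AffineSubspace.mk' p₀ (LinearMap.ker ψ), hker,
    ⟨⟨p₀, AffineSubspace.self_mem_mk' _ _⟩, by rw [AffineSubspace.direction_mk']⟩, ?_⟩
  intro y z η θ hη hθ
  obtain ⟨p, hp, hpz⟩ := (infDist_lt_iff ⟨p₁, hp₁⟩).1 hθ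
  have hmem : x + B (p - q) ∈ AffineSubspace.mk' p₀ (LinearMap.ker ψ) := by
    rw [AffineSubspace.mem_mk', LinearMap.mem_ker]
    have h1 : p - p₁ ∈ L.direction := by
      simpa using AffineSubspace.vsub_mem_direction hp hp₁
    have h2 : A (x + B (p - q) - p₀) = p - p₁ := by
      rw [hp₀, add_sub_add_left_eq_sub, ← map_sub, hAB]; abel
    rw [vsub_eq_sub, hψ, LinearMap.comp_apply, ContinuousLinearMap.coe_coe, h2]
    exact hφ h1
  refine (infDist_le_dist_of_mem hmem).trans ?_
  have e : y - (x + B (p - q)) = B (-(z - q - A (y - x)) + (z - p)) := by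
    have : -(z - q - A (y - x)) + (z - p) = A (y - x) - (p - q) := by abel
    rw [this, map_sub B (A (y - x)), hBA]; abel
  rw [dist_eq_norm, e]
  refine (B.le_opNorm _).trans ?_
  gcongr
  refine (norm_add_le _ _).trans ?_
  rw [norm_neg, ← dist_eq_norm z p]
  linarith

/-- On a compact ball, a `C¹` diffeomorphism is Lipschitz, and at small scales preimages of
neighborhoods of proper affine subspaces are contained in neighborhoods of hyperplanes, uniformly. -/
theorem IsC1DiffeoOn.exists_hyperplane {d k : ℕ} (hk : k < d)
    {f : EuclideanSpace ℝ (Fin d) → EuclideanSpace ℝ (Fin d)} {U : Set (EuclideanSpace ℝ (Fin d))}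
    (hU : IsOpen U) (hf : IsC1DiffeoOn f U) {x₀ : EuclideanSpace ℝ (Fin d)} {r₀ : ℝ}
    (hball : closedBall x₀ r₀ ⊆ U) {w : ℝ} (hw : 0 < w) :
    ∃ M κ τ : ℝ, 0 < M ∧ 0 < κ ∧ 0 < τ ∧
      (∀ x ∈ closedBall x₀ r₀, ∀ y ∈ closedBall x₀ r₀, dist (f x) (f y) ≤ M * dist x y) ∧
      ∀ x ∈ closedBall x₀ r₀, ∀ r : ℝ, 0 < r → r ≤ τ →
        ∀ L : AffineSubspace ℝ (EuclideanSpace ℝ (Fin d)), IsAffineOfDim k L →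
          ∃ (m : ℕ) (H : AffineSubspace ℝ (EuclideanSpace ℝ (Fin d))), m + 1 = d ∧
            IsAffineOfDim m H ∧ ∀ y ∈ closedBall x₀ r₀, dist y x ≤ r →
              infDist (f y) (L : Set (EuclideanSpace ℝ (Fin d))) ≤ κ * r →
                infDist y (H : Set (EuclideanSpace ℝ (Fin d))) ≤ w * r := by
  obtain ⟨hfU, hfC, g, hgC, hgf⟩ := hf
  have hK : IsCompact (closedBall x₀ r₀) := isCompact_closedBall _ _
  have hconv : Convex ℝ (closedBall x₀ r₀) := convex_closedBall _ _
  have hdf : ∀ x ∈ U, HasFDerivAt f (fderiv ℝ f x) x := fun x hx =>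
    ((hfC.differentiableOn one_ne_zero).differentiableAt (hU.mem_nhds hx)).hasFDerivAt
  have hdg : ∀ x ∈ U, HasFDerivAt g (fderiv ℝ g (f x)) (f x) := fun x hx =>
    ((hgC.differentiableOn one_ne_zero).differentiableAt
      (hfU.mem_nhds (mem_image_of_mem f hx))).hasFDerivAt
  have hcf : ContinuousOn (fderiv ℝ f) (closedBall x₀ r₀) :=
    (hfC.continuousOn_fderiv_of_isOpen hU le_rfl).mono hball
  have hcg : ContinuousOn (fun x => fderiv ℝ g (f x)) (closedBall x₀ r₀) :=
    ((hgC.continuousOn_fderiv_of_isOpen hfU le_rfl).comp hfC.continuousOn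
      (mapsTo_image f U)).mono hball
  have hBA : ∀ x ∈ U, ∀ v, fderiv ℝ g (f x) (fderiv ℝ f x v) = v := by
    intro x hx v
    have h1 := (hdg x hx).comp x (hdf x hx)
    have h2 : HasFDerivAt (g ∘ f) (ContinuousLinearMap.id ℝ _) x :=
      (hasFDerivAt_id x).congr_of_eventuallyEq
        (by filter_upwards [hU.mem_nhds hx] with y hy using hgf y hy)
    exact DFunLike.congr_fun (h1.unique h2) v
  have hAB : ∀ x ∈ U, ∀ v, fderiv ℝ f x (fderiv ℝ g (f x) v) = v := by
    intro x hx v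
    have h1 : ((fderiv ℝ g (f x) : EuclideanSpace ℝ (Fin d) →ₗ[ℝ] EuclideanSpace ℝ (Fin d))) *
        (fderiv ℝ f x : EuclideanSpace ℝ (Fin d) →ₗ[ℝ] EuclideanSpace ℝ (Fin d)) = 1 :=
      LinearMap.ext fun v => hBA x hx v
    exact LinearMap.congr_fun (mul_eq_one_comm.1 h1) v
  obtain ⟨a, ha⟩ := hK.exists_bound_of_continuousOn hcf
  obtain ⟨b', hb'⟩ := hK.exists_bound_of_continuousOn hcg
  set M := max a 1 with hM
  set b := max b' 1 with hb
  have hb0 : 0 < b := lt_max_of_lt_right one_pos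
  have huc := hK.uniformContinuousOn_of_continuous hcf
  obtain ⟨τ, hτ, huc⟩ := Metric.uniformContinuousOn_iff.1 huc (w / (2 * b)) (by positivity)
  -- Linearization error and distance to `L` each get `w / (2 * b) * r`, which the inverse
  -- derivative turns into `w * r` in total. The factor `4` provides the strict inequality for the
  -- distance to `L`, and `τ / 2` the one for uniform continuity.
  refine ⟨M, w / (4 * b), τ / 2, lt_max_of_lt_right one_pos, by positivity, by positivity, ?_, ?_⟩
  · intro x hx y hy
    rw [dist_comm, dist_comm x, dist_eq_norm, dist_eq_norm]
    exact hconv.norm_image_sub_le_of_norm_hasFDerivWithin_le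
      (fun z hz => (hdf z (hball hz)).hasFDerivWithinAt)
      (fun z hz => (ha z hz).trans (le_max_left _ _)) hx hy
  · intro x hx r hr hrτ L hL
    obtain ⟨m, H, hm, hH, h⟩ := exists_hyperplane_of_approx hk hL (fderiv ℝ f x)
      (fderiv ℝ g (f x)) (hBA x (hball hx)) (hAB x (hball hx)) hb0
      ((hb' x hx).trans (le_max_left _ _)) x (f x)
    refine ⟨m, H, hm, hH, fun y hy hyx hfy => ?_⟩
    have happ : ‖f y - f x - fderiv ℝ f x (y - x)‖ ≤ w / (2 * b) * r := by
      have hx' : x ∈ closedBall x₀ r₀ ∩ closedBall x r := ⟨hx, mem_closedBall_self hr.le⟩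
      have := (hconv.inter (convex_closedBall x r)).norm_image_sub_le_of_norm_hasFDerivWithin_le'
        (f := f) (f' := fderiv ℝ f) (φ := fderiv ℝ f x) (C := w / (2 * b))
        (fun z hz => (hdf z (hball hz.1)).hasFDerivWithinAt) (fun z hz => by
          rw [← dist_eq_norm]
          exact (huc z hz.1 x hx ((mem_closedBall.1 hz.2).trans_lt (by linarith))).le) hx'
          (y := y) ⟨hy, hyx⟩
      refine this.trans ?_
      rw [← dist_eq_norm]
      gcongr
    have hlt : infDist (f y) (L : Set (EuclideanSpace ℝ (Fin d))) < w / (2 * b) * r := by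
      refine hfy.trans_lt ?_
      gcongr
      linarith
    refine (h y (f y) _ _ happ hlt).trans_eq ?_
    field_simp
    norm_num

/-! ### Scheduling the turns of countably many games -/

theorem two_pow_mul_odd_injective {i j u v : ℕ} (h : 2 ^ i * (2 * u + 1) = 2 ^ j * (2 * v + 1)) :
    i = j ∧ u = v := by
  have key : ∀ {i j u v : ℕ}, i ≤ j → 2 ^ i * (2 * u + 1) = 2 ^ j * (2 * v + 1) →
      i = j ∧ u = v := by
    intro i j u v hij h
    obtain ⟨l, rfl⟩ := Nat.exists_eq_add_of_le hij
    rw [pow_add, mul_assoc] at h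
    have h' := Nat.eq_of_mul_eq_mul_left (by positivity) h
    rcases l with _ | l
    · simp at h'; exact ⟨rfl, h'⟩
    · rw [pow_succ, mul_comm (2 ^ l) 2, mul_assoc] at h'
      omega
  rcases le_total i j with hij | hij
  · exact key hij h
  · obtain ⟨h1, h2⟩ := key hij h.symm
    exact ⟨h1.symm, h2.symm⟩

/-- The `t`-th turn of the `i`-th of countably many games played in parallel: the turns of the
`i`-th game form an arithmetic progression of difference `2 ^ (i + 1 + e i)`, and the turns of
different games are disjoint. -/
def turn (e T : ℕ → ℕ) (i t : ℕ) : ℕ := 2 ^ i * (2 * (2 ^ e i * (T i + t)) + 1)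

theorem turn_injective {e T : ℕ → ℕ} {i j t u : ℕ} (h : turn e T i t = turn e T j u) :
    i = j ∧ t = u := by
  obtain ⟨rfl, h2⟩ := two_pow_mul_odd_injective h
  have := Nat.eq_of_mul_eq_mul_left (by positivity) h2
  exact ⟨rfl, by omega⟩

theorem turn_succ (e T : ℕ → ℕ) (i t : ℕ) :
    turn e T i (t + 1) = turn e T i t + 2 ^ (i + 1 + e i) := by
  simp only [turn]; ring

theorem turn_mono (e T : ℕ → ℕ) (i : ℕ) : StrictMono (turn e T i) :=
  strictMono_nat_of_lt_succ fun t => by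
    rw [turn_succ]; exact Nat.lt_add_of_pos_right (by positivity)

theorem le_turn (e T : ℕ → ℕ) (i t : ℕ) : T i ≤ turn e T i t := by
  have h1 : 1 ≤ 2 ^ i := Nat.one_le_two_pow
  have h2 : 1 ≤ 2 ^ e i := Nat.one_le_two_pow
  simp only [turn]
  nlinarith [Nat.zero_le (2 ^ e i * t), Nat.mul_le_mul h2 (le_refl (T i + t)),
    Nat.mul_le_mul h1 (le_refl (2 * (2 ^ e i * (T i + t)) + 1))]

/-! ### Winning a single game along a branch -/

theorem dist_le_sub_of_dist_succ_le {E : Type*} [PseudoMetricSpace E] {x : ℕ → E} {R : ℕ → ℝ}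
    (h : ∀ n, dist (x n) (x (n + 1)) ≤ R n - R (n + 1)) {n m : ℕ} (hnm : n ≤ m) :
    dist (x n) (x m) ≤ R n - R m := by
  induction m, hnm using Nat.le_induction with
  | base => simp
  | succ m _ ih => linarith [dist_triangle (x n) (x m) (x (m + 1)), h m]

/-- If the turns of a single game are played at the levels `n 0 < n 1 < …` of a branch `x` which
stays away from the preimages of the sets removed by Alice, then the limit of the branch is mapped
into `S`. -/
theorem mem_of_avoids_answers {d k : ℕ} {b : ℝ}
    {S : Set (EuclideanSpace ℝ (Fin d))} {σ : AliceStrategy d k b}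
    (hσ : ∀ (x : ℕ → EuclideanSpace ℝ (Fin d)) (ρ : ℕ → ℝ),
      IsLegalPlay σ x ρ → ((⋂ n, closedBall (x n) (ρ n)) ∩ S).Nonempty)
    {y : ℕ → EuclideanSpace ℝ (Fin d)} {ρ : ℕ → ℝ} (hρ : ∀ t, 0 < ρ t)
    (hρsucc : ∀ t, ρ (t + 1) = b * ρ t) (hρlim : Tendsto ρ atTop (𝓝 0))
    (hnest : ∀ t, dist (y (t + 1)) (y t) ≤ ρ t - ρ (t + 1))
    (havoid : ∀ t, 2 * b * ρ t <
      infDist (y (t + 1)) ((σ.answer y ρ t).L : Set (EuclideanSpace ℝ (Fin d))))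
    {z : EuclideanSpace ℝ (Fin d)} (hz : Tendsto y atTop (𝓝 z)) : z ∈ S := by
  have hlegal : IsLegalPlay σ y ρ := by
    refine ⟨hρ, fun t => (hρsucc t).ge, fun t p hp => ⟨?_, fun hpc => ?_⟩⟩
    · exact closedBall_subset_closedBall' (by linarith [hnest t]) hp
    -- Half of the margin `2 * b * ρ t` covers the radius of Bob's next ball, the other half the
    -- removed neighborhood.
    · set A := σ.answer y ρ t with hA
      have hne : (A.L : Set (EuclideanSpace ℝ (Fin d))).Nonempty := A.isAffineOfDim.1
      have hερ : 0 ≤ A.ε * ρ t := (mul_pos A.ε_pos (hρ t)).le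
      have h1 : infDist p (A.L : Set (EuclideanSpace ℝ (Fin d))) ≤ A.ε * ρ t := by
        rw [mem_cthickening_iff] at hpc
        exact ENNReal.toReal_le_of_le_ofReal hερ hpc
      have h2 := infDist_le_infDist_add_dist (s := (A.L : Set (EuclideanSpace ℝ (Fin d))))
        (x := y (t + 1)) (y := p)
      have h3 := mem_closedBall'.1 hp
      have h4 : A.ε * ρ t ≤ b * ρ t := mul_le_mul_of_nonneg_right A.ε_le (hρ t).le
      have := havoid t
      rw [hρsucc] at h3
      linarith
  obtain ⟨p, hp, hpS⟩ := hσ y ρ hlegal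
  have hlim : Tendsto y atTop (𝓝 p) := by
    rw [tendsto_iff_dist_tendsto_zero]
    exact squeeze_zero (fun _ => dist_nonneg)
      (fun t => mem_closedBall'.1 (mem_iInter.1 hp t)) hρlim
  exact tendsto_nhds_unique hlim hz ▸ hpS

theorem AliceStrategy.answer_congr {d k : ℕ} {b : ℝ} (σ : AliceStrategy d k b)
    {y y' : ℕ → EuclideanSpace ℝ (Fin d)} (ρ : ℕ → ℝ) {t : ℕ} (h : ∀ j ≤ t, y j = y' j) :
    σ.answer y ρ t = σ.answer y' ρ t := by
  unfold AliceStrategy.answer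
  congr 1
  funext j
  rw [h j (Nat.lt_succ_iff.1 j.2)]

/-! ### Playing all games on one tree -/

theorem corollary5p4 {d k : ℕ} (hk : k < d)
    (μ : MeasureTheory.Measure (EuclideanSpace ℝ (Fin d)))
    [MeasureTheory.IsLocallyFiniteMeasure μ]
    (hμ : IsAbsolutelyDecaying μ) (hμ' : IsAhlforsRegular μ)
    (S : Set (EuclideanSpace ℝ (Fin d))) (hS : IsAbsoluteWinning k S) :
    IsStronglyC1Incompressible S μ.support := by
  obtain ⟨C, γ, ρ₀, hC, hγ, hρ₀, hdec⟩ := hμ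
  obtain ⟨δ, c₁, c₂, ρ₁, hδ, hc₁, hc₂, hρ₁, hreg⟩ := hμ'
  intro U hU hUK f hf
  obtain ⟨x₀, hx₀U, hx₀K⟩ := hUK
  refine le_antisymm (dimH_mono fun p hp => ⟨(mem_iInter.1 hp.1 0).1, hp.2⟩) ?_
  refine ((dimH_mono inter_subset_right).trans (dimH_support_le_of_le_measure_closedBall μ hδ hc₁ hρ₁
    fun x hx ρ h1 h2 => (hreg x hx ρ h1 h2).1)).trans ?_
  suffices hmain : ∀ s, 0 < s → s < δ →
      ENNReal.ofReal s ≤ dimH ((⋂ i, U ∩ f i ⁻¹' S) ∩ μ.support) by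
    refine le_of_forall_lt fun a ha => ?_
    obtain ⟨s, has, hsδ⟩ := ENNReal.lt_iff_exists_nnreal_btwn.1 ha
    have hs0 : 0 < (s : ℝ) := by
      have : (0 : ENNReal) < s := bot_lt_iff_ne_bot.2 has.ne_bot
      exact_mod_cast this
    refine has.trans_le ?_
    have := hmain s hs0 ((ENNReal.ofReal_lt_ofReal_iff hδ).1 (by simpa using hsδ))
    simpa using this
  intro s hs hsδ
  obtain ⟨N, β, hN, hβ, hβ3, hNs, hchild⟩ := exists_separated_children hγ hdec hc₁ hc₂ hreg hs hsδ
  obtain ⟨r₀, hr₀, hr₀ρ, hball⟩ : ∃ r₀, 0 < r₀ ∧ r₀ < min ρ₀ ρ₁ ∧ closedBall x₀ r₀ ⊆ U := by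
    obtain ⟨r, hr, hrU⟩ := Metric.nhds_basis_closedBall.mem_iff.1 (hU.mem_nhds hx₀U)
    have hmin : 0 < min ρ₀ ρ₁ := lt_min hρ₀ hρ₁
    exact ⟨min r (min ρ₀ ρ₁ / 2), by positivity,
      (min_le_right _ _).trans_lt (half_lt_self hmin),
      (closedBall_subset_closedBall (min_le_left _ _)).trans hrU⟩
  choose M κ τ hM hκ hτ hlip hhyp using fun i =>
    (hf i).exists_hyperplane hk hU hball (w := β) hβ
  have hβ1 : β < 1 := by linarith
  have hpow : ∀ c : ℝ, 0 < c → ∃ n, ∀ m, n ≤ m → β ^ m < c := fun c hc =>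
    eventually_atTop.1 ((tendsto_pow_atTop_nhds_zero_of_lt_one hβ.le hβ1).eventually_lt_const hc)
  choose e he using fun i => hpow (κ i / (2 * M i)) (div_pos (hκ i) (by linarith [hM i]))
  choose T hTτ using fun i => hpow (τ i / r₀) (div_pos (hτ i) hr₀)
  -- The ratio of the scales at consecutive turns of game `i`, so that Bob's radii shrink exactly by
  -- the parameter; `e i` makes it small against `κ i / M i`.
  set b : ℕ → ℝ := fun i => β ^ 2 ^ (i + 1 + e i) with hbdef
  have hb0 : ∀ i, 0 < b i := fun i => by positivity
  have hbκ : ∀ i, 2 * b i * M i < κ i := by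
    intro i
    have h1 : e i ≤ 2 ^ (i + 1 + e i) := by
      have := Nat.lt_two_pow_self (n := i + 1 + e i)
      omega
    have h2 := he i _ h1
    rw [lt_div_iff₀ (by linarith [hM i])] at h2
    simp only [hbdef]
    linarith
  have hb3 : ∀ i, b i < 1 / 3 := fun i =>
    (pow_le_of_le_one hβ.le hβ1.le (by positivity)).trans_lt hβ3
  choose σ hσ using fun i => hS (b i) (hb0 i) (hb3 i)
  set R : ℕ → ℝ := fun n => r₀ * β ^ n with hR
  have hR0 : ∀ n, 0 < R n := fun n => by positivity
  have hRsucc : ∀ n, R (n + 1) = β * R n := fun n => by simp only [hR]; ring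
  have hRle : ∀ n, R n ≤ r₀ := fun n => mul_le_of_le_one_right hr₀.le (pow_le_one₀ hβ.le hβ1.le)
  have hRlim : Tendsto R atTop (𝓝 0) := by
    simpa using (tendsto_pow_atTop_nhds_zero_of_lt_one hβ.le hβ1).const_mul r₀
  set ans : (i : ℕ) → (ℕ → EuclideanSpace ℝ (Fin d)) → ℕ → AliceMove d k (b i) :=
    fun i x t => (σ i).answer (fun j => f i (x (turn e T i j)))
      (fun j => M i * R (turn e T i j)) t with hans
  set V : ℕ → Set (EuclideanSpace ℝ (Fin d)) :=
    fun n => μ.support ∩ closedBall x₀ (r₀ - R n) with hV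
  have hVball : ∀ n, V n ⊆ closedBall x₀ r₀ := fun n =>
    inter_subset_right.trans (closedBall_subset_closedBall (by linarith [hR0 n]))
  -- The bound is required on the whole ball around the child, because Bob's next center in game `i`
  -- is chosen only at the next turn, many levels further down.
  set Q : ℕ → (ℕ → EuclideanSpace ℝ (Fin d)) → EuclideanSpace ℝ (Fin d) → Prop :=
    fun n x y => ∀ i t, turn e T i t = n → ∀ z ∈ closedBall x₀ r₀, dist y z ≤ β * R n →
      κ i * R n < infDist (f i z) ((ans i x t).L : Set (EuclideanSpace ℝ (Fin d))) with hQ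
  have hhyper : ∀ n (x : ℕ → EuclideanSpace ℝ (Fin d)), x n ∈ V n →
      ∃ (m : ℕ) (H : AffineSubspace ℝ (EuclideanSpace ℝ (Fin d))), m + 1 = d ∧
        IsAffineOfDim m H ∧ ∀ i t, turn e T i t = n → ∀ z ∈ closedBall x₀ r₀, dist z (x n) ≤ R n →
          infDist (f i z) ((ans i x t).L : Set (EuclideanSpace ℝ (Fin d))) ≤ κ i * R n →
            infDist z (H : Set (EuclideanSpace ℝ (Fin d))) ≤ β * R n := by
    intro n x hx
    by_cases hn : ∃ i t, turn e T i t = n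
    · obtain ⟨i, t, hit⟩ := hn
      have hRτ : R n ≤ τ i := by
        have := hTτ i n (hit ▸ le_turn e T i t)
        rw [lt_div_iff₀ hr₀] at this
        simp only [hR]
        linarith
      obtain ⟨m, H, hm, hH, h⟩ := hhyp i (x n) (hVball n hx) (R n) (hR0 n) hRτ (ans i x t).L
        (ans i x t).isAffineOfDim
      refine ⟨m, H, hm, hH, fun i' t' hit' => ?_⟩
      obtain ⟨rfl, rfl⟩ := turn_injective (hit'.trans hit.symm)
      exact h
    -- No game has its turn at this level, so any hyperplane will do.
    · obtain ⟨m, H, hm, hH, -⟩ := hhyp 0 x₀ (mem_closedBall_self hr₀.le) (τ 0) (hτ 0) le_rfl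
        (ans 0 x 0).L (ans 0 x 0).isAffineOfDim
      exact ⟨m, H, hm, hH, fun i t hit => absurd ⟨i, t, hit⟩ hn⟩
  refine le_dimH_of_tree hN hβ hβ1 hr₀ hs hNs V Q ?_ (x₀ := x₀) ?_ ?_ ?_
  · intro n x x' y hxx' hQx i t hit
    have : ans i x t = ans i x' t := AliceStrategy.answer_congr _ _ fun j hj => by
      rw [hxx' _ (hit ▸ (turn_mono e T i).monotone hj)]
    rw [← this]
    exact hQx i t hit
  · exact ⟨hx₀K, by simp [hR]⟩
  · intro n x hx
    obtain ⟨m, H, hm, hH, h⟩ := hhyper n x hx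
    obtain ⟨y, hy, hsep⟩ := hchild (x n) hx.1 (R n) (hR0 n) ((hRle n).trans_lt hr₀ρ) m H hm hH
    refine ⟨y, fun j => ⟨⟨(hy j).1, ?_⟩, (hy j).2.1, ?_⟩, hsep⟩
    · have h1 := mem_closedBall.1 hx.2
      have h2 := (hy j).2.1
      rw [mem_closedBall, hRsucc]
      linarith [dist_triangle_left (y j) x₀ (x n)]
    · intro i t hit z hz hyz
      -- The child is more than `2 * β * R n` from `H` and `z` is within `β * R n` of it, so `z` is
      -- more than `β * R n` from `H`.
      by_contra! hcon
      have h1 : dist z (x n) ≤ R n := by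
        have := dist_triangle (x n) (y j) z
        rw [dist_comm z]
        linarith [(hy j).2.1]
      have h2 := h i t hit z hz h1 hcon
      have h3 := infDist_le_infDist_add_dist (s := (H : Set (EuclideanSpace ℝ (Fin d))))
        (x := y j) (y := z)
      linarith [(hy j).2.2]
  · intro x hxV hxd hxQ z hz
    have hxball : ∀ n, x n ∈ closedBall x₀ r₀ := fun n => hVball n (hxV n)
    have hdist : ∀ {n m}, n ≤ m → dist (x n) (x m) ≤ R n - R m := fun hnm =>
      dist_le_sub_of_dist_succ_le (fun n => by rw [hRsucc]; linarith [hxd n]) hnm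
    have hzU : z ∈ U :=
      hball (isClosed_closedBall.mem_of_tendsto hz (Eventually.of_forall hxball))
    refine ⟨mem_iInter.2 fun i => ⟨hzU, ?_⟩,
      Measure.isClosed_support.mem_of_tendsto hz (Eventually.of_forall fun n => (hxV n).1)⟩
    have hturn : Tendsto (turn e T i) atTop atTop := (turn_mono e T i).tendsto_atTop
    have hRturn : ∀ t, R (turn e T i (t + 1)) = b i * R (turn e T i t) := fun t => by
      simp only [hR, hbdef, turn_succ, pow_add β]; ring
    -- Radii are scaled by the Lipschitz constant `M i`, so that nesting of the balls in the tree
    -- passes to Bob's balls around the image points.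
    refine mem_of_avoids_answers (hσ i) (y := fun t => f i (x (turn e T i t)))
      (ρ := fun t => M i * R (turn e T i t)) (fun t => mul_pos (hM i) (hR0 _)) ?_ ?_ ?_ ?_ ?_
    · intro t
      rw [hRturn]; ring
    · simpa using (hRlim.comp hturn).const_mul (M i)
    · intro t
      refine (hlip i _ (hxball _) _ (hxball _)).trans ?_
      rw [dist_comm, ← mul_sub]
      exact mul_le_mul_of_nonneg_left (hdist ((turn_mono e T i) t.lt_succ_self).le) (hM i).le
    · intro t
      have h1 := hdist (Nat.succ_le_of_lt ((turn_mono e T i) t.lt_succ_self))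
      have h2 := hxQ (turn e T i t) i t rfl (x (turn e T i (t + 1))) (hxball _) (by
        refine h1.trans ?_
        rw [Nat.succ_eq_add_one, hRsucc]
        linarith [hR0 (turn e T i (t + 1))])
      refine lt_trans ?_ h2
      have := mul_lt_mul_of_pos_right (hbκ i) (hR0 (turn e T i t))
      linarith
    · have hcont : ContinuousAt (f i) z :=
        (hf i).2.1.continuousOn.continuousAt (hU.mem_nhds hzU)
      exact hcont.tendsto.comp (hz.comp hturn)
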